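/- Let $k$ be a commutative ring and $G$ a group. Let $B = B(G,k)$ be the $kG$-module of all functions $G\to k$ that take only finitely many values, with $(g\cdot f)(x) = f(g^{-1}x)$. A $kG$-module $M$ is called cofibrant if the $kG$-module $M\otimes_k B$ (with diagonal $G$-action) is projective; $M$ has finite cofibrant dimension if, for some $n\ge 0$, there is an exact sequence of $kG$-modules $0\to C_n\to\cdots\to C_0\to M\to 0$ with every $C_i$ cofibrant. Let $\underline{\mathtt{Cof}}(kG)$ be the stable category of cofibrant modules: its objects are the cofibrant $kG$-modules, and its morphisms are the $kG$-linear maps modulo those that factor through a projective $kG$-module. Let $\mathbf{D}^b_{sg}(kG) = \mathbf{D}^b(kG)/\mathbf{K}^b(\mathrm{Proj}(kG))$ be the singularity category, that is, the Verdier quotient of the bounded derived category of all $kG$-modules by the bounded complexes of projective $kG$-modules. Let $F:\underline{\mathtt{Cof}}(kG)\to\mathbf{D}^b_{sg}(kG)$ be the canonical functor, which sends a cofibrant module to the corresponding complex concentrated in degree zero. **Proposition.** If $F$ is dense (that is, essentially surjective), then every $kG$-module has finite cofibrant dimension. -/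

import Mathlib

open CategoryTheory Limits Pretriangulated ZeroObject

universe w v' u' u v

/-! ## Singularity category and stable categories of an abelian category -/

section AbelianCategory

variable {C : Type u'} [Category.{v'} C] [Abelian C]

/-- Two morphisms between objects of a full subcategory are stably equal when their difference
factors through a projective object of the ambient abelian category. -/
def stableRel (P : ObjectProperty C) : HomRel P.FullSubcategory := fun X Y f g =>
  ∃ (Q : C) (_ : Projective Q) (a : X.obj ⟶ Q) (b : Q ⟶ Y.obj), f.hom - g.hom = a ≫ b

/-- Stable equality is already a congruence, so that passing to the quotient category below
identifies exactly the stably equal morphisms. -/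
instance stableRel_congruence (P : ObjectProperty C) : Congruence (stableRel P) where
  comp_left := by
    rintro X Y Z f g g' ⟨Q, hQ, a, b, h⟩
    refine ⟨Q, hQ, f.hom ≫ a, b, ?_⟩
    simp [← h, Preadditive.comp_sub]
  comp_right := by
    rintro X Y Z f f' g ⟨Q, hQ, a, b, h⟩
    refine ⟨Q, hQ, a, b ≫ g.hom, ?_⟩
    simp [← Category.assoc, ← h, Preadditive.sub_comp]
  equivalence := by
    intro X Y
    refine ⟨fun f => ⟨(0 : C), inferInstance, 0, 0, by simp⟩, ?_, ?_⟩
    · rintro f g ⟨Q, hQ, a, b, h⟩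
      exact ⟨Q, hQ, -a, b, by simp [← h]⟩
    · rintro f g l ⟨Q, hQ, a, b, h⟩ ⟨Q', hQ', a', b', h'⟩
      refine ⟨Q ⊞ Q', inferInstance, biprod.lift a a', biprod.desc b b', ?_⟩
      simp [← h, ← h']

/-- The stable category of a full subcategory of an abelian category: the same objects, and
morphisms modulo those that factor through a projective object. -/
abbrev StableCategory (P : ObjectProperty C) := CategoryTheory.Quotient (stableRel P)

variable (C) [HasDerivedCategory.{w} C]

/-- The objects of the bounded derived category that are isomorphic to a bounded complex of
projective objects, that is, the image of `K^b(Proj C)` in `D^b(C)`. -/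
def perfectComplexes : ObjectProperty (DerivedCategory.Bounded C) := fun X =>
  ∃ K : CochainComplex C ℤ, (∀ i, Projective (K.X i)) ∧
    (∃ a b : ℤ, K.IsStrictlyGE a ∧ K.IsStrictlyLE b) ∧
    Nonempty (X.obj ≅ DerivedCategory.Q.obj K)

/-- The singularity category `D^b_sg(C)`: the Verdier quotient `D^b(C) / K^b(Proj C)`, obtained
from `D^b(C)` by inverting the morphisms whose cone lies in `K^b(Proj C)`. -/
abbrev SingularityCategory := (perfectComplexes C).trW.Localization

/-- The localization functor `D^b(C) ⥤ D^b_sg(C)`. -/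
noncomputable abbrev toSingularityCategory : DerivedCategory.Bounded C ⥤ SingularityCategory C :=
  (perfectComplexes C).trW.Q

/-- The embedding of `C` into `D^b(C)` as complexes concentrated in degree zero. -/
noncomputable def boundedSingleFunctor : C ⥤ DerivedCategory.Bounded C :=
  ObjectProperty.lift _ (DerivedCategory.singleFunctor C 0)
    (fun X => ⟨⟨0, (inferInstance : ((DerivedCategory.singleFunctor C 0).obj X).IsGE 0)⟩,
      ⟨0, (inferInstance : ((DerivedCategory.singleFunctor C 0).obj X).IsLE 0)⟩⟩)

variable {C}

/-- A projective object, placed in degree zero, belongs to `K^b(Proj C)`. -/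
lemma perfectComplexes_single (X : C) [Projective X] :
    perfectComplexes C ((boundedSingleFunctor C).obj X) := by
  refine ⟨(CochainComplex.singleFunctor C 0).obj X, fun i => ?_, ⟨0, 0, ?_, ?_⟩,
    ⟨(DerivedCategory.singleFunctorIsoCompQ C 0).app X⟩⟩
  · by_cases hi : i = 0
    · subst hi
      exact Projective.of_iso
        (HomologicalComplex.singleObjXSelf (ComplexShape.up ℤ) 0 X).symm inferInstance
    · exact Projective.of_iso
        (HomologicalComplex.isZero_single_obj_X (ComplexShape.up ℤ) 0 X i hi).isoZero.symm
        inferInstance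
  · exact (inferInstance :
      CochainComplex.IsStrictlyGE
        ((HomologicalComplex.single C (ComplexShape.up ℤ) 0).obj X) 0)
  · exact (inferInstance :
      CochainComplex.IsStrictlyLE
        ((HomologicalComplex.single C (ComplexShape.up ℤ) 0).obj X) 0)

/-- The composite `C ⥤ D^b(C) ⥤ D^b_sg(C)` identifies morphisms whose difference factors through a
projective object. -/
lemma map_eq_of_stable {X Y Q : C} [Projective Q] (f g : X ⟶ Y) (a : X ⟶ Q) (b : Q ⟶ Y)
    (h : f - g = a ≫ b) :
    (boundedSingleFunctor C ⋙ toSingularityCategory C).map f =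
      (boundedSingleFunctor C ⋙ toSingularityCategory C).map g := by
  let S := boundedSingleFunctor C
  let L := toSingularityCategory C
  have hS : S.map f = S.map g + S.map a ≫ S.map b := by
    have hf : f = g + a ≫ b := by rw [← h]; abel
    have hadd : ∀ u v : X ⟶ Y, S.map (u + v) = S.map u + S.map v := by
      intro u v
      ext
      exact (DerivedCategory.singleFunctor C 0).map_add
    rw [hf, hadd, S.map_comp]
  have hinl : (perfectComplexes C).trW (biprod.inl : S.obj Y ⟶ S.obj Y ⊞ S.obj Q) :=
    ObjectProperty.trW.mk _ (binaryBiproductTriangle_distinguished (S.obj Y) (S.obj Q))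
      (perfectComplexes_single Q)
  have : IsIso (L.map (biprod.inl : S.obj Y ⟶ S.obj Y ⊞ S.obj Q)) :=
    MorphismProperty.Q_inverts _ _ hinl
  have key : L.map (biprod.desc (𝟙 (S.obj Y)) (S.map b)) =
      L.map (biprod.desc (𝟙 (S.obj Y)) (0 : S.obj Q ⟶ S.obj Y)) := by
    rw [← cancel_epi (L.map (biprod.inl : S.obj Y ⟶ S.obj Y ⊞ S.obj Q)), ← L.map_comp,
      ← L.map_comp, biprod.inl_desc, biprod.inl_desc]
  have h₁ : S.map f =
      biprod.lift (S.map g) (S.map a) ≫ biprod.desc (𝟙 (S.obj Y)) (S.map b) := by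
    rw [biprod.lift_desc, hS, Category.comp_id]
  have h₂ : S.map g =
      biprod.lift (S.map g) (S.map a) ≫ biprod.desc (𝟙 (S.obj Y)) (0 : S.obj Q ⟶ S.obj Y) := by
    rw [biprod.lift_desc, Category.comp_id, comp_zero, add_zero]
  change L.map (S.map f) = L.map (S.map g)
  rw [h₁, L.map_comp, key, ← L.map_comp, ← h₂]

/-- The canonical functor from the stable category of a full subcategory `P` of `C` to the
singularity category, sending an object `X` of `P` to the complex `X` concentrated in degree zero
and the class of a morphism `f` to the class of `f`. -/
noncomputable def stableToSingularity (P : ObjectProperty C) :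
    StableCategory P ⥤ SingularityCategory C :=
  CategoryTheory.Quotient.lift (stableRel P)
    (P.ι ⋙ boundedSingleFunctor C ⋙ toSingularityCategory C)
    (fun _ _ f g ⟨_, _, a, b, h⟩ => map_eq_of_stable f.hom g.hom a b h)

end AbelianCategory

/-! ## Cofibrant modules over a group algebra

The category of `kG`-modules is `Rep k G`; it is equivalent to `ModuleCat (MonoidAlgebra k G)` by
`Rep.equivalenceModuleMonoidAlgebra`. -/

section GroupAlgebra

variable (k : Type u) (G : Type v) [CommRing k] [Group G]

/-- The `k`-module of functions `G → k` that take only finitely many values. -/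
def boundedFunctions : Submodule k (G → k) where
  carrier := {f | (Set.range f).Finite}
  zero_mem' := (Set.finite_singleton (0 : k)).subset (by rintro _ ⟨x, rfl⟩; rfl)
  add_mem' := by
    intro f g hf hg
    refine (Set.Finite.image2 (· + ·) hf hg).subset ?_
    rintro _ ⟨x, rfl⟩
    exact ⟨f x, ⟨x, rfl⟩, g x, ⟨x, rfl⟩, rfl⟩
  smul_mem' := by
    intro c f hf
    refine (hf.image (c • ·)).subset ?_
    rintro _ ⟨x, rfl⟩
    exact ⟨f x, ⟨x, rfl⟩, rfl⟩

/-- The `kG`-module `B(G, k)`: the group acts on functions by `(g • f) x = f (g⁻¹ x)`. -/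
def boundedRepresentation : Representation k G (boundedFunctions k G) where
  toFun g :=
    { toFun := fun f => ⟨fun x => f.1 (g⁻¹ * x), f.2.subset (by rintro _ ⟨x, rfl⟩; exact ⟨_, rfl⟩)⟩
      map_add' := fun _ _ => rfl
      map_smul' := fun _ _ => rfl }
  map_one' := by
    ext f x
    simp
  map_mul' := by
    intro g h
    ext f x
    simp [mul_assoc]

variable {k G}

/-- A `kG`-module `M` is cofibrant if `M ⊗_k B(G, k)`, with diagonal action, is projective. -/
def cofibrant : ObjectProperty (Rep.{max u v} k G) := fun M =>
  Projective (Rep.of.{max u v} (M.ρ.tprod (boundedRepresentation k G)))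

/-- `CofibrantDimensionLE n M` says that there is an exact sequence
`0 → Cₙ → ⋯ → C₁ → C₀ → M → 0` with all `Cᵢ` cofibrant. -/
inductive CofibrantDimensionLE : ℕ → Rep.{max u v} k G → Prop
  | zero (M : Rep.{max u v} k G) (hM : cofibrant M) : CofibrantDimensionLE 0 M
  | succ (n : ℕ) (S : ShortComplex (Rep.{max u v} k G)) (hS : S.ShortExact)
      (h₂ : cofibrant S.X₂) (h₁ : CofibrantDimensionLE n S.X₁) :
      CofibrantDimensionLE (n + 1) S.X₃

/-- A `kG`-module has finite cofibrant dimension if it has a finite resolution by cofibrant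
modules. -/
def HasFiniteCofibrantDimension (M : Rep.{max u v} k G) : Prop :=
  ∃ n : ℕ, CofibrantDimensionLE n M

end GroupAlgebra

/-!
A `kG`-module `M` has finite cofibrant dimension as soon as `M ⊗ B` has finite projective dimension,
where `B = B(G, k)` with the diagonal action: tensoring a projective resolution of `M` with `B`
gives a projective resolution of `M ⊗ B`, so a high syzygy `Ω` of `M` has `Ω ⊗ B` projective, that
is, it is cofibrant, and so are the projectives of the resolution
(`cofibrantDimensionLE_of_hasProjectiveDimensionLE`).

It remains to see that `M ⊗ B` has finite projective dimension when `M` becomes isomorphic in the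
singularity category to a cofibrant module `N`, which exists by density. The functor `- ⊗ B` is
exact and preserves projectives, so it acts on derived categories and sends bounded complexes of
projectives to bounded complexes of projectives. The objects of `D^b(kG)` that it sends to objects
of finite projective dimension, in the sense that `Hom(X, Y⟦n⟧) = 0` for all modules `Y` and all
large `n`, form a thick subcategory that contains `K^b(Proj(kG))` and also contains `N`, because
`N ⊗ B` is projective. As the kernel of a Verdier quotient functor through which the singularity
category factors, this subcategory is closed under isomorphism in the singularity category, so it
contains `M` (`exists_hasProjectiveDimensionLT_of_singularity_iso`).

That `- ⊗ B` is exact and preserves projectives (`tensorFunctor_preservesProjectiveObjects`)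
rests on `B(G, k)` being a free `k`-module (`boundedFunctions_free`). Bounded functions on `G` are
the locally constant functions on the Stone–Čech compactification of the discrete set `G`; over `ℤ`
they form a free module by Nöbeling's theorem, and a basis over `ℤ` remains a basis over `k`.
-/

/-! ### Bounded functions form a free module -/

section FreeModules

namespace LocallyConstant

variable {X : Type*} [TopologicalSpace X] {k : Type*} [CommRing k]

/-- A locally constant function on a compact space is the finite sum of its values times the
indicator functions of its fibres. -/
lemma eq_sum_smul_charFn [CompactSpace X] (f : LocallyConstant X k) :
    f = ∑ c ∈ f.range_finite.toFinset, c • charFn k (f.isLocallyConstant.isClopen_fiber c) := by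
  classical
  ext x
  have h := map_sum (coeFnₗ k (X := X) (Y := k))
    (fun c => c • charFn k (f.isLocallyConstant.isClopen_fiber c)) f.range_finite.toFinset
  have h' := congrFun h x
  simp only [coeFnₗ_apply, Finset.sum_apply, coe_smul, Pi.smul_apply, coe_charFn] at h'
  rw [h', Finset.sum_eq_single (f x)]
  · simp
  · intro c _ hc
    simp [Set.indicator, hc.symm]
  · simp

variable (k) in
/-- Composition with the canonical map `ℤ → k`. -/
def intCastMap : LocallyConstant X ℤ →+ LocallyConstant X k where
  toFun f := f.map (Int.cast : ℤ → k)
  map_zero' := by ext; simp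
  map_add' f g := by ext; simp

@[simp]
lemma intCastMap_apply (f : LocallyConstant X ℤ) (x : X) : intCastMap k f x = (f x : k) := rfl

lemma intCastMap_charFn {U : Set X} (hU : IsClopen U) :
    intCastMap k (charFn ℤ hU) = charFn k hU := by
  classical
  ext x
  simp [coe_charFn, Set.indicator]

variable [CompactSpace X] {ι : Type*} (b : Module.Basis ι ℤ (LocallyConstant X ℤ))

/-- The matrix expressing finitely many basis vectors through the indicator functions of their
common fibres has a left inverse over `ℤ`, given by the coordinates of these indicators; so it is
injective over every ring. -/
lemma linearIndependent_intCastMap : LinearIndependent k fun i => intCastMap k (b i) := by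
  classical
  rw [linearIndependent_iff']
  intro s c hc i hi
  let φ : LocallyConstant X (s → ℤ) :=
    ⟨fun x l => b l x, (IsLocallyConstant.iff_continuous _).2
      (continuous_pi fun l => (b l).continuous)⟩
  let e (v : s → ℤ) := charFn ℤ (φ.isLocallyConstant.isClopen_fiber v)
  have hb (l : s) : b l = ∑ v ∈ φ.range_finite.toFinset, v l • e v := by
    ext x
    have h := congrFun (map_sum (coeFnₗ ℤ (X := X) (Y := ℤ))
      (fun v => v l • e v) φ.range_finite.toFinset) x
    simp only [coeFnₗ_apply, Finset.sum_apply, coe_smul, Pi.smul_apply, e, coe_charFn] at h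
    rw [h, Finset.sum_eq_single (φ x)]
    · simp [φ]
    · intro v _ hv
      simp [Set.indicator, hv.symm]
    · simp
  have hrel (v : s → ℤ) (hv : v ∈ φ.range_finite.toFinset) : ∑ l : s, c l * (v l : k) = 0 := by
    obtain ⟨x, rfl⟩ : ∃ x, φ x = v := by simpa using hv
    have h := congrFun (map_sum (coeFnₗ k (X := X) (Y := k))
      (fun l => c l • intCastMap k (b l)) s) x
    rw [hc, map_zero, Pi.zero_apply] at h
    simp only [coeFnₗ_apply, Finset.sum_apply, coe_smul, Pi.smul_apply,
      intCastMap_apply, smul_eq_mul] at h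
    rw [← Finset.sum_coe_sort s (fun l => c l * ((b l x : ℤ) : k))] at h
    exact h.symm
  have hδ (l : s) : (if l = ⟨i, hi⟩ then (1 : ℤ) else 0) =
      ∑ v ∈ φ.range_finite.toFinset, v l * b.repr (e v) i := by
    have h := congrArg (fun f => b.repr f i) (hb l)
    simp only [map_sum, map_smul, Finsupp.coe_finsetSum, Finset.sum_apply, Finsupp.smul_apply,
      smul_eq_mul, Module.Basis.repr_self, Finsupp.single_apply] at h
    rw [← h]
    simp [Subtype.ext_iff]
  calc c i = ∑ l : s, c l * ((if l = ⟨i, hi⟩ then (1 : ℤ) else 0 : ℤ) : k) := by simp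
    _ = ∑ v ∈ φ.range_finite.toFinset, (∑ l : s, c l * (v l : k)) * (b.repr (e v) i : k) := by
        simp_rw [hδ, Finset.sum_mul]
        rw [Finset.sum_comm]
        refine Finset.sum_congr rfl fun l _ => ?_
        push_cast
        rw [Finset.mul_sum]
        exact Finset.sum_congr rfl fun v _ => by ring
    _ = 0 := Finset.sum_eq_zero fun v hv => by rw [hrel v hv, zero_mul]

lemma span_intCastMap : ⊤ ≤ Submodule.span k (Set.range fun i => intCastMap k (b i)) := by
  intro f _
  rw [f.eq_sum_smul_charFn]
  refine Submodule.sum_mem _ fun c _ => Submodule.smul_mem _ _ ?_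
  rw [← intCastMap_charFn, ← b.linearCombination_repr (charFn ℤ _),
    Finsupp.linearCombination_apply, Finsupp.sum, map_sum]
  refine Submodule.sum_mem _ fun i _ => ?_
  rw [map_zsmul]
  exact zsmul_mem (Submodule.subset_span (Set.mem_range_self i)) _

/-- The extension of Nöbeling's theorem from `ℤ` to arbitrary commutative rings of
coefficients. -/
lemma free_of_profinite (S : Profinite.{v}) : Module.Free k (LocallyConstant S k) :=
  let b := Module.Free.chooseBasis ℤ (LocallyConstant S ℤ)
  Module.Free.of_basis (Module.Basis.mk (linearIndependent_intCastMap (k := k) b)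
    (span_intCastMap b))

end LocallyConstant

variable (k : Type u) (G : Type v) [CommRing k]

/-- Restriction along `G → βG`, where the Stone–Čech compactification `βG` of the discrete space
`G` is realized as the space of ultrafilters. -/
def restrictUltrafilter : LocallyConstant (Ultrafilter G) k →ₗ[k] boundedFunctions k G where
  toFun f := ⟨fun g => f (pure g), f.range_finite.subset (by rintro _ ⟨g, rfl⟩; exact ⟨_, rfl⟩)⟩
  map_add' _ _ := rfl
  map_smul' _ _ := rfl

lemma restrictUltrafilter_bijective : Function.Bijective (restrictUltrafilter k G) := by
  classical
  constructor
  · intro f g h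
    let : TopologicalSpace k := ⊥
    have : DiscreteTopology k := ⟨rfl⟩
    have := denseRange_pure.equalizer f.continuous g.continuous (congrArg Subtype.val h)
    exact LocallyConstant.coe_injective this
  · intro f
    have hU (c : k) : IsClopen {u : Ultrafilter G | f.1 ⁻¹' {c} ∈ u} :=
      ⟨ultrafilter_isClosed_basic _, ultrafilter_isOpen_basic _⟩
    refine ⟨∑ c ∈ (show (Set.range f.1).Finite from f.2).toFinset,
      c • LocallyConstant.charFn k (hU c), Subtype.ext (funext fun g => ?_)⟩
    have h := congrFun (map_sum (LocallyConstant.coeFnₗ k (X := Ultrafilter G) (Y := k))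
      (fun c => c • LocallyConstant.charFn k (hU c))
      (show (Set.range f.1).Finite from f.2).toFinset) (pure g)
    refine h.trans ?_
    simp only [LocallyConstant.coeFnₗ_apply, Finset.sum_apply, LocallyConstant.coe_smul,
      Pi.smul_apply, LocallyConstant.coe_charFn]
    rw [Finset.sum_eq_single (f.1 g)]
    · simp [Set.indicator]
    · intro c _ hc
      simp [Set.indicator, hc.symm]
    · simp

instance boundedFunctions_free : Module.Free k (boundedFunctions k G) :=
  haveI : Module.Free k (LocallyConstant (Ultrafilter G) k) :=
    LocallyConstant.free_of_profinite (Profinite.of (Ultrafilter G))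
  Module.Free.of_equiv (LinearEquiv.ofBijective _ (restrictUltrafilter_bijective k G))

end FreeModules

/-! ### Verdier quotients -/

section Verdier

variable {C : Type u'} [Category.{v'} C] [HasZeroObject C] [HasShift C ℤ] [Preadditive C]
  [∀ n : ℤ, (shiftFunctor C n).Additive] [Pretriangulated C] [IsTriangulated C]
  (P : ObjectProperty C) [P.IsTriangulated]

/-- A triangulated subcategory that is stable under retracts is exactly the kernel of its Verdier
quotient functor. -/
lemma isZero_trW_Q_obj_iff [P.IsStableUnderRetracts] (X : C) : IsZero (P.trW.Q.obj X) ↔ P X := by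
  constructor
  · intro h
    obtain ⟨Y, s, hs, h₀⟩ := (MorphismProperty.map_eq_iff_postcomp P.trW.Q P.trW (𝟙 X) 0).1
      (h.eq_of_src _ _)
    obtain rfl : s = 0 := by simpa using h₀
    obtain ⟨Z, a, b, hT, hZ⟩ := hs
    -- The cone of `0 : X ⟶ Y` contains `X⟦1⟧` as a direct summand.
    obtain ⟨i, hi⟩ := Triangle.coyoneda_exact₁ _ hT (𝟙 (X⟦(1 : ℤ)⟧))
      ((Category.id_comp _).trans ((shiftFunctor C (1 : ℤ)).map_zero _ _))
    have hX : P (X⟦(1 : ℤ)⟧) := P.prop_of_retract ⟨i, b, hi.symm⟩ hZ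
    have := P.le_shift (-1 : ℤ) _ hX
    exact P.prop_of_retract (Retract.ofIso ((shiftEquiv C (1 : ℤ)).unitIso.app X)) this
  · intro h
    rw [IsZero.iff_id_eq_zero, ← P.trW.Q.map_id, ← P.trW.Q.map_zero]
    exact (MorphismProperty.map_eq_iff_postcomp P.trW.Q P.trW (𝟙 X) 0).2
      ⟨0, 0, ⟨_, _, _, rot_of_distTriang _ (contractible_distinguished X), P.le_shift 1 _ h⟩,
        by simp⟩

variable {P}

/-- Isomorphism in a quotient by any class of objects contained in a thick subcategory preserves
membership in this thick subcategory. -/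
lemma prop_of_trW_localization_iso [P.IsStableUnderRetracts] {P' : ObjectProperty C}
    (hP : P' ≤ P) {X Y : C} (e : P'.trW.Q.obj X ≅ P'.trW.Q.obj Y) (hX : P X) : P Y := by
  let F : P'.trW.Localization ⥤ P.trW.Localization :=
    Localization.lift P.trW.Q
      (fun _ _ f hf => MorphismProperty.Q_inverts _ _ (ObjectProperty.trW_monotone hP _ hf))
      P'.trW.Q
  let η : P'.trW.Q ⋙ F ≅ P.trW.Q := Localization.fac _ _ _
  rw [← isZero_trW_Q_obj_iff P] at hX ⊢
  exact hX.of_iso ((η.app Y).symm ≪≫ F.mapIso e.symm ≪≫ η.app X)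

end Verdier

/-! ### Objects of finite projective dimension in the derived category -/

section FiniteProjectiveDimension

variable (C : Type u') [Category.{v'} C] [Abelian C] [HasDerivedCategory.{w} C]

/-- The objects `X` of the derived category of finite projective dimension: those for which
`Hom(X, Y⟦n⟧)` vanishes for all objects `Y` of the abelian category and all large `n`, uniformly
in `Y`. -/
def finiteProjectiveDimension : ObjectProperty (DerivedCategory C) := fun X =>
  ∃ d : ℤ, ∀ n : ℤ, d ≤ n → ∀ (Y : C)
    (f : X ⟶ ((DerivedCategory.singleFunctor C 0).obj Y)⟦n⟧), f = 0

instance : (finiteProjectiveDimension C).IsStableUnderRetracts where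
  of_retract r h := by
    obtain ⟨d, hd⟩ := h
    refine ⟨d, fun n hn Y f => ?_⟩
    rw [← Category.id_comp f, ← r.retract, Category.assoc, hd n hn Y (r.r ≫ f), comp_zero]

instance : (finiteProjectiveDimension C).IsClosedUnderIsomorphisms where
  of_iso e h := ObjectProperty.prop_of_retract _ (Retract.ofIso e.symm) h

instance : (finiteProjectiveDimension C).IsTriangulated where
  exists_zero := ⟨0, isZero_zero _, 0, fun _ _ _ f => (isZero_zero _).eq_of_src _ _⟩
  isStableUnderShiftBy a :=
    { le_shift := by
        rintro X ⟨d, hd⟩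
        refine ⟨d + a, fun n hn Y f => ?_⟩
        let e := (shiftFunctorAdd' (DerivedCategory C) (n - a) a n (by lia)).app
          ((DerivedCategory.singleFunctor C 0).obj Y)
        obtain ⟨g, hg⟩ := (shiftFunctor (DerivedCategory C) a).map_surjective (f ≫ e.hom)
        rw [hd (n - a) (by lia) Y g, Functor.map_zero] at hg
        rw [← cancel_mono e.hom, zero_comp, hg] }
  toIsTriangulatedClosed₂ := .mk' fun T hT ⟨d₁, h₁⟩ ⟨d₃, h₃⟩ =>
    ⟨max d₁ d₃, fun n hn Y f => by
      obtain ⟨g, rfl⟩ := Triangle.yoneda_exact₂ _ hT f (h₁ n (le_of_max_le_left hn) Y _)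
      rw [h₃ n (le_of_max_le_right hn) Y g, comp_zero]⟩

variable {C}

/-- A bounded complex of projectives is K-projective, so that maps out of it in the derived
category are given by chain maps; these vanish for degree reasons. -/
lemma finiteProjectiveDimension_Q_obj (K : CochainComplex C ℤ) (hK : ∀ i, Projective (K.X i))
    (a b : ℤ) (ha : K.IsStrictlyGE a) (hb : K.IsStrictlyLE b) :
    finiteProjectiveDimension C (DerivedCategory.Q.obj K) := by
  have := CochainComplex.isKProjective_of_projective K b
  refine ⟨1 - a, fun n hn Y f => ?_⟩
  let S := (CochainComplex.singleFunctor C 0).obj Y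
  let e : ((DerivedCategory.singleFunctor C 0).obj Y)⟦n⟧ ≅ DerivedCategory.Q.obj (S⟦n⟧) :=
    (shiftFunctor _ n).mapIso ((DerivedCategory.singleFunctorIsoCompQ C 0).app Y) ≪≫
      (DerivedCategory.Q.commShiftIso n).symm.app S
  have hS : (S⟦n⟧).IsStrictlyLE (-n) := CochainComplex.isStrictlyLE_shift _ 0 _ _ (by lia)
  rw [← cancel_mono e.hom, zero_comp]
  let q := DerivedCategory.quotientCompQhIso C
  obtain ⟨g, hg⟩ := (CochainComplex.IsKProjective.Qh_map_bijective K
    ((HomotopyCategory.quotient _ _).obj (S⟦n⟧))).surjective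
      (q.hom.app K ≫ (f ≫ e.hom) ≫ q.inv.app (S⟦n⟧))
  obtain ⟨g, rfl⟩ := (HomotopyCategory.quotient _ _).map_surjective g
  -- `K` lives in degrees `≥ a`, and `S⟦n⟧` in degrees `≤ -n < a`.
  obtain rfl : g = 0 := by
    ext i
    by_cases hi : i < a
    · exact (K.isZero_of_isStrictlyGE a i hi).eq_of_src _ _
    · exact ((S⟦n⟧).isZero_of_isStrictlyLE (-n) i (by lia)).eq_of_tgt _ _
  rw [Functor.map_zero, Functor.map_zero] at hg
  rw [← cancel_epi (q.hom.app K), ← cancel_mono (q.inv.app (S⟦n⟧)), comp_zero, zero_comp,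
    Category.assoc]
  exact hg.symm

lemma exists_hasProjectiveDimensionLT_of_finiteProjectiveDimension {M : C}
    (h : finiteProjectiveDimension C ((DerivedCategory.singleFunctor C 0).obj M)) :
    ∃ n : ℕ, HasProjectiveDimensionLT M n := by
  obtain ⟨d, hd⟩ := h
  have := hasExt_of_hasDerivedCategory.{w} C
  refine ⟨d.toNat, HasProjectiveDimensionLT.mk.{w} fun i hi Y e => ?_⟩
  ext
  exact (hd i (by lia) Y _).trans (hd i (by lia) Y _).symm

variable {D : Type u} [Category.{v} D] [Abelian D] [HasDerivedCategory.{w} D]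

/-- An exact functor that preserves projectives sends bounded complexes of projectives to objects
of finite projective dimension. -/
lemma perfectComplexes_le_inverseImage (F : C ⥤ D) [F.Additive] [PreservesFiniteLimits F]
    [PreservesFiniteColimits F] [F.PreservesProjectiveObjects] :
    perfectComplexes C ≤ (finiteProjectiveDimension D).inverseImage
      (DerivedCategory.Bounded.ι ⋙ F.mapDerivedCategory) := by
  rintro X ⟨K, hK, ⟨a, b, ha, hb⟩, ⟨e⟩⟩
  let K' := (F.mapHomologicalComplex (ComplexShape.up ℤ)).obj K
  have hK' : finiteProjectiveDimension D (DerivedCategory.Q.obj K') :=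
    finiteProjectiveDimension_Q_obj K' (fun i => F.projective_obj (K.X i)) a b
      ((CochainComplex.isStrictlyGE_iff _ _).2 fun i hi =>
        F.map_isZero (K.isZero_of_isStrictlyGE a i hi))
      ((CochainComplex.isStrictlyLE_iff _ _).2 fun i hi =>
        F.map_isZero (K.isZero_of_isStrictlyLE b i hi))
  exact ObjectProperty.prop_of_iso (finiteProjectiveDimension D)
    (F.mapDerivedCategory.mapIso e ≪≫ F.mapDerivedCategoryFactors.app K).symm hK'

/-- If `M` becomes isomorphic in the singularity category to an object `N` and `F` is an exact
functor preserving projectives such that `F N` is projective, then `F M` has finite projective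
dimension. -/
lemma exists_hasProjectiveDimensionLT_of_singularity_iso (F : C ⥤ D) [F.Additive]
    [PreservesFiniteLimits F] [PreservesFiniteColimits F] [F.PreservesProjectiveObjects]
    {M N : C} (hN : Projective (F.obj N))
    (e : (toSingularityCategory C).obj ((boundedSingleFunctor C).obj N) ≅
      (toSingularityCategory C).obj ((boundedSingleFunctor C).obj M)) :
    ∃ n : ℕ, HasProjectiveDimensionLT (F.obj M) n := by
  let P := (finiteProjectiveDimension D).inverseImage
      (DerivedCategory.Bounded.ι ⋙ F.mapDerivedCategory)
  have : P.IsStableUnderRetracts :=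
    ⟨fun r h => ObjectProperty.prop_of_retract (finiteProjectiveDimension D)
      (r.map (DerivedCategory.Bounded.ι ⋙ F.mapDerivedCategory)) h⟩
  have hP : P ((boundedSingleFunctor C).obj N) := by
    obtain ⟨K, hK, ⟨a, b, ha, hb⟩, ⟨e'⟩⟩ := perfectComplexes_single (F.obj N)
    exact ObjectProperty.prop_of_iso (finiteProjectiveDimension D)
      (e'.symm ≪≫ (F.mapDerivedCategorySingleFunctor 0).symm.app N)
      (finiteProjectiveDimension_Q_obj K hK a b ha hb)
  have hM : P ((boundedSingleFunctor C).obj M) :=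
    prop_of_trW_localization_iso (perfectComplexes_le_inverseImage F) e hP
  exact exists_hasProjectiveDimensionLT_of_finiteProjectiveDimension
    (ObjectProperty.prop_of_iso _ ((F.mapDerivedCategorySingleFunctor 0).app M) hM)

end FiniteProjectiveDimension

/-! ### The functor `- ⊗ B(G, k)` -/

section TensorFunctor

open scoped TensorProduct

variable {k : Type u} {G : Type v} [CommRing k] [Group G]

variable {V : Type max u v} [AddCommGroup V] [Module k V] (ρ : Representation k G V)

/-- The functor `M ↦ M ⊗ V` on representations, with the diagonal action on `M ⊗ V`. -/
noncomputable def tensorFunctor : Rep.{max u v} k G ⥤ Rep.{max u v} k G where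
  obj M := Rep.of (M.ρ.tprod ρ)
  map f := Rep.ofHom (f.hom.rTensor ρ)
  map_id M := by
    ext1
    exact Representation.IntertwiningMap.rTensor_id
  map_comp f g := by
    apply Rep.hom_ext
    ext x y
    rfl

instance : (tensorFunctor ρ).Additive where
  map_add {_ _ f g} := Rep.hom_ext (Representation.IntertwiningMap.rTensor_add f.hom g.hom)

lemma tensorFunctor_map_shortExact [Module.Flat k V] (S : ShortComplex (Rep.{max u v} k G))
    (hS : S.ShortExact) : (S.map (tensorFunctor ρ)).ShortExact := by
  have h := hS.map_of_exact (forget₂ (Rep.{max u v} k G) (ModuleCat.{max u v} k))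
  have hf : Function.Injective S.f.hom.toLinearMap := h.moduleCat_injective_f
  have hg : Function.Surjective S.g.hom.toLinearMap := h.moduleCat_surjective_g
  have hfg : Function.Exact S.f.hom.toLinearMap S.g.hom.toLinearMap :=
    (ShortComplex.ShortExact.moduleCat_exact_iff_function_exact _).1 h.exact
  refine ShortComplex.ShortExact.mk' ?_ ?_ ?_
  · apply (forget₂ (Rep.{max u v} k G) (ModuleCat.{max u v} k)).reflects_exact_of_faithful
    exact (ShortComplex.ShortExact.moduleCat_exact_iff_function_exact _).2
      (rTensor_exact V hfg hg)
  · exact (Rep.mono_iff_injective _).2 (Module.Flat.rTensor_preserves_injective_linearMap _ hf)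
  · exact (Rep.epi_iff_surjective _).2 (LinearMap.rTensor_surjective V hg)

instance [Module.Flat k V] : PreservesFiniteLimits (tensorFunctor ρ) :=
  (Functor.preservesFiniteLimits_iff_forall_exact_map_and_mono _).2 fun S hS =>
    have h := tensorFunctor_map_shortExact ρ S hS
    ⟨h.exact, h.mono_f⟩

instance [Module.Flat k V] : PreservesFiniteColimits (tensorFunctor ρ) :=
  (Functor.preservesFiniteColimits_iff_forall_exact_map_and_epi _).2 fun S hS =>
    have h := tensorFunctor_map_shortExact ρ S hS
    ⟨h.exact, h.epi_g⟩

/-- Equivariant maps `M ⊗ V → N` are lifted along epimorphisms by lifting their curried forms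
`M → Hom_k(V, N)`; the functor `Hom_k(V, -)` preserves
epimorphisms since `V` is projective over `k`. -/
instance tensorFunctor_preservesProjectiveObjects [Module.Projective k V] :
    (tensorFunctor ρ).PreservesProjectiveObjects where
  projective_obj {P} hP := ⟨fun {E X} f p hp => by
    let H (N : Rep.{max u v} k G) : Rep.{max u v} k G := Rep.of (Representation.linHom ρ N.ρ)
    let Hp : H E ⟶ H X := Rep.ofHom ⟨LinearMap.llcomp k _ _ _ p.hom.toLinearMap, fun g => by
      ext φ x
      exact (Rep.hom_comm_apply p g _)⟩
    have : Epi Hp := (Rep.epi_iff_surjective _).2 fun φ =>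
      Module.projective_lifting_property p.hom.toLinearMap φ ((Rep.epi_iff_surjective p).1 hp)
    let f' : P ⟶ H X := Rep.ofHom ⟨TensorProduct.curry f.hom.toLinearMap, fun g => by
      ext m x
      have h := Rep.hom_comm_apply f g (m ⊗ₜ[k] ρ g⁻¹ x)
      -- The diagonal action of `g` cancels the `g⁻¹` in the action on `Hom_k(V, X)`.
      have hx : ((tensorFunctor ρ).obj P).ρ g (m ⊗ₜ[k] ρ g⁻¹ x) = P.ρ g m ⊗ₜ[k] x := by
        change P.ρ g m ⊗ₜ[k] ρ g (ρ g⁻¹ x) = _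
        rw [Representation.self_inv_apply]
      rw [hx] at h
      exact h⟩
    let l : P ⟶ H E := Projective.factorThru f' Hp
    have hl : l ≫ Hp = f' := Projective.factorThru_comp _ _
    refine ⟨Rep.ofHom ⟨TensorProduct.lift l.hom.toLinearMap, fun g => ?_⟩, ?_⟩
    · ext m x
      have h := LinearMap.congr_fun (Rep.hom_comm_apply l g m) (ρ g x)
      have hx : ((H E).ρ g (l.hom m) : V →ₗ[k] E) (ρ g x) = E.ρ g (l.hom m x) := by
        change E.ρ g (l.hom m (ρ g⁻¹ (ρ g x))) = _
        rw [Representation.inv_self_apply]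
      exact h.trans hx
    · have h : p.hom.toLinearMap ∘ₗ TensorProduct.lift l.hom.toLinearMap = f.hom.toLinearMap :=
        TensorProduct.ext' fun m x =>
          LinearMap.congr_fun (congrArg (fun q : P ⟶ H X => q.hom m) hl) x
      ext z
      exact LinearMap.congr_fun h z⟩

end TensorFunctor

/-! ### Cofibrant dimension and projective dimension -/

section CofibrantDimension

variable {k : Type u} {G : Type v} [CommRing k] [Group G]

instance enoughProjectives_rep : EnoughProjectives (Rep.{max u v} k G) :=
  Rep.equivalenceModuleMonoidAlgebra.enoughProjectives_iff.2
    ModuleCat.enoughProjectives.{max u v}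

lemma cofibrant_of_projective (P : Rep.{max u v} k G) [Projective P] : cofibrant P :=
  (tensorFunctor (boundedRepresentation k G)).projective_obj P

/-- If `M ⊗ B` has finite projective dimension, then a sufficiently high syzygy of `M` is
cofibrant. -/
lemma cofibrantDimensionLE_of_hasProjectiveDimensionLE (n : ℕ) (M : Rep.{max u v} k G)
    (hM : HasProjectiveDimensionLT ((tensorFunctor (boundedRepresentation k G)).obj M) (n + 1)) :
    CofibrantDimensionLE n M := by
  induction n generalizing M with
  | zero => exact .zero M (projective_iff_hasProjectiveDimensionLT_one.2 hM)
  | succ n ih =>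
    let S : ShortComplex (Rep.{max u v} k G) :=
      ShortComplex.mk _ _ (kernel.condition (Projective.π M))
    have hS : S.ShortExact := { exact := ShortComplex.exact_kernel (Projective.π M) }
    have hP : cofibrant S.X₂ := cofibrant_of_projective (Projective.over M)
    exact .succ n S hS hP (ih _
      (((tensorFunctor_map_shortExact _ S hS).hasProjectiveDimensionLT_X₃_iff n hP).1 hM))

end CofibrantDimension

theorem mainTheorem6 {k : Type u} {G : Type v} [CommRing k] [Group G]
    [HasDerivedCategory.{w} (Rep.{max u v} k G)]
    (hF : (stableToSingularity (cofibrant (k := k) (G := G))).EssSurj) :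
    ∀ M : Rep.{max u v} k G, HasFiniteCofibrantDimension M := by
  intro M
  obtain ⟨N, ⟨e⟩⟩ := hF.mem_essImage
    ((toSingularityCategory _).obj ((boundedSingleFunctor _).obj M))
  obtain ⟨n, hn⟩ := exists_hasProjectiveDimensionLT_of_singularity_iso
    (tensorFunctor (boundedRepresentation k G)) (M := M) (N := N.as.obj) N.as.property e
  exact ⟨n, cofibrantDimensionLE_of_hasProjectiveDimensionLE n M
    (hasProjectiveDimensionLT_of_ge _ n (n + 1) n.le_succ)⟩
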